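/- Let $(\mathbb{E},\|\cdot\|)$ be a complex Banach space, $q>1$ and $\kappa>0$ real numbers, $k\ge 1$ an integer. Let $\{\mathcal{E}_{p',p}\}_{0\le p\le\varsigma-1,\,0\le p'\le\chi_p-1}$ be a good covering in $\mathbb{C}^*$: a finite family of at least two open sectors with vertex at $0$ (not containing $0$), aperture at most $2\pi$ and common radius $\epsilon_0>0$, which can be enumerated cyclically in such a way that any two consecutive sectors intersect, such that any three different sectors have empty intersection, and whose union is $\mathcal{U}\setminus\{0\}$ for some neighbourhood $\mathcal{U}$ of $0$. For all $p,p'$ let $G_{p',p}:\mathcal{E}_{p',p}\to\mathbb{E}$ be holomorphic. Assume: 1. each $G_{p',p}(\epsilon)$ is bounded as $\epsilon\in\mathcal{E}_{p',p}$ tends to $0$; 2. for all $p$ and $p_1\ne p_2$ with $\mathcal{E}_{p_1,p}\cap\mathcal{E}_{p_2,p}\ne\emptyset$ there are $K_1,M_1>0$ with $$\|G_{p_2,p}(\epsilon)-G_{p_1,p}(\epsilon)\|\le K_1\exp\left(-\frac{M_1}{|\epsilon|^k}\right)\quad\text{for all }\epsilon\in\mathcal{E}_{p_1,p}\cap\mathcal{E}_{p_2,p};$$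 3. for all $p\ne p'$ and all $p_1,p_2$ with $\mathcal{E}_{p_1,p}\cap\mathcal{E}_{p_2,p'}\ne\emptyset$ there are $K_2>0$ and $M_2\in\mathbb{R}$ with $$\|G_{p_2,p'}(\epsilon)-G_{p_1,p}(\epsilon)\|\le K_2|\epsilon|^{M_2}\exp\left(-\frac{\kappa}{2\log q}\log^2|\epsilon|\right)\quad\text{for all }\epsilon\in\mathcal{E}_{p_1,p}\cap\mathcal{E}_{p_2,p'}.$$ Then there are a power series $a(\epsilon)$ with coefficients in $\mathbb{E}$, convergent on the disc $|\epsilon|<\epsilon_0$, and formal power series $\hat G_1(\epsilon)=\sum_{n\ge0}g_{1,n}\epsilon^n$, $\hat G_2(\epsilon)=\sum_{n\ge0}g_{2,n}\epsilon^n$ in $\mathbb{E}[[\epsilon]]$ such that for all $p$ and $p_1$ $$G_{p_1,p}(\epsilon)=a(\epsilon)+G^1_{p_1,p}(\epsilon)+G^2_{p_1,p}(\epsilon)\quad\text{for all }\epsilon\in\mathcal{E}_{p_1,p},$$ where $G^1_{p_1,p}$ and $G^2_{p_1,p}$ are holomorphic on $\mathcal{E}_{p_1,p}$ and: - $G^1_{p_1,p}$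 admits $\hat G_1$ as its $1/k$-Gevrey asymptotic expansion on $\mathcal{E}_{p_1,p}$, that is, for every closed subsector $\mathcal{W}=\{re^{i\varphi}:0<r\le\rho,\ \alpha\le\varphi\le\beta\}\subseteq\mathcal{E}_{p_1,p}$ there are $C,M>0$ with $$\Big\|G^1_{p_1,p}(\epsilon)-\sum_{n=0}^{N-1}g_{1,n}\epsilon^n\Big\|\le CM^N(N!)^{1/k}|\epsilon|^N\quad\text{for all }N\ge1,\ \epsilon\in\mathcal{W};$$ - $G^2_{p_1,p}$ admits $\hat G_2$ as its $q$-Gevrey asymptotic expansion of order $1/\kappa$ on $\mathcal{E}_{p_1,p}$, that is, for every open subsector $U$ with vertex at $0$ and $\overline{U}\setminus\{0\}\subseteq\mathcal{E}_{p_1,p}$ there are $C,A>0$ with $$\Big\|G^2_{p_1,p}(\epsilon)-\sum_{n=0}^{N}g_{2,n}\epsilon^n\Big\|\le CA^{N+1}q^{\frac{(N+1)N}{2\kappa}}|\epsilon|^{N+1}\quad\text{for all }N\ge0,\ \epsilon\in U.$$ -/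

import Mathlib

open Topology

namespace RamisSibuya

/-- The open sector with vertex at the origin, radius `r` and arguments in `(a, b)`
(the vertex does not belong to it). -/
def openSector (a b r : ℝ) : Set ℂ :=
  {z | ∃ ρ φ : ℝ, 0 < ρ ∧ ρ < r ∧ a < φ ∧ φ < b ∧ z = ρ * Complex.exp (φ * Complex.I)}

/-- The closed sector (closed in `ℂ \ {0}`) with vertex at the origin, radius `r` and arguments in
`[a, b]`; the vertex does not belong to it. -/
def closedSector (a b r : ℝ) : Set ℂ :=
  {z | ∃ ρ φ : ℝ, 0 < ρ ∧ ρ ≤ r ∧ a ≤ φ ∧ φ ≤ b ∧ z = ρ * Complex.exp (φ * Complex.I)}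

/-- `V` is an open sector in `ℂ` with vertex at the origin, radius `r` and aperture at most `2π`. -/
def IsOpenSector (r : ℝ) (V : Set ℂ) : Prop :=
  ∃ a b : ℝ, a < b ∧ b ≤ a + 2 * Real.pi ∧ V = openSector a b r

/-- A good covering in `ℂ \ {0}` by open sectors of common radius `ε₀`: at least two sectors, which
can be enumerated cyclically so that consecutive ones meet, no point lies in three different ones,
and the union is a punctured neighbourhood of the origin. -/
structure IsGoodCovering {ι : Type*} (ε₀ : ℝ) (E : ι → Set ℂ) : Prop where
  radius_pos : 0 < ε₀
  sector : ∀ i, IsOpenSector ε₀ (E i)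
  cyclic : ∃ n : ℕ, 2 ≤ n ∧ ∃ e : ZMod n ≃ ι, ∀ j : ZMod n, (E (e j) ∩ E (e (j + 1))).Nonempty
  triple : ∀ i j l, i ≠ j → j ≠ l → i ≠ l → E i ∩ E j ∩ E l = ∅
  union : ∃ U ∈ 𝓝 (0 : ℂ), ⋃ i, E i = U \ {0}

/-- `f` admits the formal power series `∑ cₙ εⁿ` as its `1/α`-Gevrey asymptotic expansion on the
open sector `V`. A formal power series is given by its sequence of coefficients. -/
def HasGevreyExpansion {F : Type*} [NormedAddCommGroup F] [NormedSpace ℂ F]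
    (α : ℝ) (f : ℂ → F) (c : ℕ → F) (V : Set ℂ) : Prop :=
  ∀ a b r : ℝ, a < b → 0 < r → closedSector a b r ⊆ V →
    ∃ C M : ℝ, 0 < C ∧ 0 < M ∧ ∀ N : ℕ, 1 ≤ N → ∀ ε ∈ closedSector a b r,
      ‖f ε - ∑ n ∈ Finset.range N, ε ^ n • c n‖ ≤
        C * M ^ N * (Nat.factorial N : ℝ) ^ (1 / α) * ‖ε‖ ^ N

/-- `f` admits the formal power series `∑ cₙ εⁿ` as its `q`-Gevrey asymptotic expansion of order
`1/κ` on the open sector `V`. The closure of a subsector is taken in `ℂ \ {0}`. -/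
def HasQGevreyExpansion {F : Type*} [NormedAddCommGroup F] [NormedSpace ℂ F]
    (q κ : ℝ) (f : ℂ → F) (c : ℕ → F) (V : Set ℂ) : Prop :=
  ∀ a b r : ℝ, a < b → 0 < r → closure (openSector a b r) \ {0} ⊆ V →
    ∃ C A : ℝ, 0 < C ∧ 0 < A ∧ ∀ N : ℕ, ∀ ε ∈ openSector a b r,
      ‖f ε - ∑ n ∈ Finset.range (N + 1), ε ^ n • c n‖ ≤
        C * A ^ (N + 1) * q ^ ((((N : ℝ) + 1) * (N : ℝ)) / (2 * κ)) * ‖ε‖ ^ (N + 1)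

end RamisSibuya

/-!
The differences of the given functions on overlaps form a holomorphic cocycle that vanishes to
infinite order at the origin. Because no three different sectors meet, this cocycle is the sum of
two cocycles: the entries whose indices have the same `p` (exponentially flat of order `k`) and
those whose indices have different `p` (`q`-exponentially flat). Each of them is split separately.

Splitting a flat cocycle `δ` on the covering `E`
(`IsConicCovering.exists_holomorphic_splitting`): a partition of unity `θ` subordinate to `E` and
homogeneous of degree zero gives smooth functions `ψ i = ∑ l, θ l • δ l i` with coboundary `δ`.
Their `∂̄`-derivatives agree on overlaps and form a function `ω` on the disc, which is bounded up to
the outer circle and as flat at the origin as `δ / |z|`. The Cauchy transform of `ω` solves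
`∂̄u = ω` (`differentiableOn_sub_cauchyTransform`, from the Cauchy–Pompeiu formula
`cauchyTransform_dbar`), so the functions `ψ i - u` are holomorphic with coboundary `δ`. Expanding
the Cauchy kernel in a finite geometric series gives an asymptotic expansion of `u`, whose `N`-th
remainder is at most a constant times `sup |ω(ζ)| |ζ|⁻ᴺ · |z|ᴺ`
(`exists_cauchyTransform_expansion`). These estimates hold uniformly on the full sectors.

Exponential flatness of order `k` turns the suprema into Gevrey constants (`exp_neg_div_pow_le`),
`q`-exponential flatness into `q`-Gevrey ones (`rpow_mul_exp_neg_log_sq_le`). Subtracting both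
splittings from the given functions leaves functions that agree on overlaps and stay bounded at the
origin, hence a holomorphic function on the disc (`IsConicCovering.exists_hasSum`).
-/

namespace RamisSibuya

open MeasureTheory Set Filter Metric
open scoped Real

/-! ### The Cauchy–Riemann operator -/

section Dbar

variable {F : Type*} [NormedAddCommGroup F] [NormedSpace ℂ F]

/-- Twice the Cauchy–Riemann operator, `2 ∂f/∂z̄ = ∂f/∂x + i ∂f/∂y`. -/
noncomputable def dbar (f : ℂ → F) (z : ℂ) : F :=
  fderiv ℝ f z 1 + Complex.I • fderiv ℝ f z Complex.I

theorem dbar_congr {f g : ℂ → F} {z : ℂ} (h : f =ᶠ[𝓝 z] g) : dbar f z = dbar g z := by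
  simp only [dbar, h.fderiv_eq]

theorem dbar_add {f g : ℂ → F} {z : ℂ} (hf : DifferentiableAt ℝ f z)
    (hg : DifferentiableAt ℝ g z) : dbar (fun w => f w + g w) z = dbar f z + dbar g z := by
  simp only [dbar, fderiv_fun_add hf hg, add_apply, smul_add]
  abel

theorem dbar_sum {ι : Type*} (s : Finset ι) {f : ι → ℂ → F} {z : ℂ}
    (hf : ∀ i ∈ s, DifferentiableAt ℝ (f i) z) :
    dbar (fun w => ∑ i ∈ s, f i w) z = ∑ i ∈ s, dbar (f i) z := by
  simp only [dbar, fderiv_fun_sum hf, sum_apply, Finset.smul_sum,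
    Finset.sum_add_distrib]

theorem dbar_eq_zero {f : ℂ → F} {z : ℂ} (hf : DifferentiableAt ℂ f z) : dbar f z = 0 := by
  have h : fderiv ℝ f z Complex.I = Complex.I • fderiv ℝ f z 1 := by
    rw [hf.fderiv_restrictScalars ℝ]
    simp only [ContinuousLinearMap.coe_restrictScalars']
    rw [← map_smul, smul_eq_mul, mul_one]
  rw [dbar, h, smul_smul, Complex.I_mul_I, neg_one_smul, add_neg_cancel]

theorem dbar_smul {θ : ℂ → ℝ} {g : ℂ → F} {z : ℂ} (hθ : DifferentiableAt ℝ θ z)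
    (hg : DifferentiableAt ℂ g z) :
    dbar (fun w => θ w • g w) z =
      (((fderiv ℝ θ z 1 : ℝ) : ℂ) + Complex.I * ((fderiv ℝ θ z Complex.I : ℝ) : ℂ)) • g z := by
  have h0 := dbar_eq_zero hg
  have hg' : DifferentiableAt ℝ g z := hg.restrictScalars ℝ
  rw [dbar] at h0
  rw [dbar, fderiv_fun_smul hθ hg']
  simp only [add_apply, smul_apply,
    ContinuousLinearMap.smulRight_apply, add_smul, mul_smul, smul_add, Complex.coe_smul]
  have h1 : θ z • fderiv ℝ g z 1 + Complex.I • θ z • fderiv ℝ g z Complex.I = 0 := by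
    rw [smul_comm Complex.I (θ z), ← smul_add, h0, smul_zero]
  calc _ = (θ z • fderiv ℝ g z 1 + Complex.I • θ z • fderiv ℝ g z Complex.I) +
        (fderiv ℝ θ z 1 • g z + Complex.I • fderiv ℝ θ z Complex.I • g z) := by abel
    _ = _ := by rw [h1, zero_add]

theorem norm_dbar_smul_le {θ : ℂ → ℝ} {g : ℂ → F} {z : ℂ} (hθ : DifferentiableAt ℝ θ z)
    (hg : DifferentiableAt ℂ g z) :
    ‖dbar (fun w => θ w • g w) z‖ ≤ 2 * ‖fderiv ℝ θ z‖ * ‖g z‖ := by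
  rw [dbar_smul hθ hg, norm_smul]
  gcongr
  refine (norm_add_le _ _).trans ?_
  rw [norm_mul, Complex.norm_I, one_mul, Complex.norm_real, Complex.norm_real]
  have h1 := (fderiv ℝ θ z).le_opNorm 1
  have h2 := (fderiv ℝ θ z).le_opNorm Complex.I
  rw [norm_one] at h1
  rw [Complex.norm_I] at h2
  linarith

theorem continuousOn_dbar {f : ℂ → F} {s : Set ℂ} (hs : IsOpen s) (hf : ContDiffOn ℝ 1 f s) :
    ContinuousOn (dbar f) s := by
  have h := hf.continuousOn_fderiv_of_isOpen hs le_rfl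
  exact (h.clm_apply continuousOn_const).add ((h.clm_apply continuousOn_const).const_smul _)

end Dbar

/-! ### The Cauchy–Pompeiu formula and the Cauchy transform -/

section Pompeiu

/-- A continuous function on the plane that vanishes for large values of the first variable is
integrable on the polar coordinate domain. -/
theorem integrable_polar_of_continuous
    {F : Type*} [NormedAddCommGroup F] {A : ℝ × ℝ → F} (hA : Continuous A) {R : ℝ}
    (hR : ∀ p : ℝ × ℝ, R < p.1 → A p = 0) :
    Integrable A ((volume.restrict (Ioi (0 : ℝ))).prod (volume.restrict (Ioo (-π) π))) := by
  rw [Measure.prod_restrict, ← Measure.volume_eq_prod]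
  have h : IntegrableOn A (Icc (0 : ℝ) R ×ˢ Icc (-π) π) :=
    hA.continuousOn.integrableOn_compact (isCompact_Icc.prod isCompact_Icc)
  refine h.of_forall_sdiff_eq_zero (measurableSet_Ioi.prod measurableSet_Ioo) ?_
  rintro ⟨r, φ⟩ ⟨⟨h1, h2⟩, h3⟩
  refine hR _ ?_
  by_contra h4
  exact h3 ⟨⟨le_of_lt h1, not_lt.1 h4⟩, ⟨h2.1.le, h2.2.le⟩⟩

variable {F : Type*} [NormedAddCommGroup F] [NormedSpace ℂ F]

/-- The Cauchy–Pompeiu formula at the origin. In polar coordinates `ζ⁻¹ ∂̄f dA` is the sum of a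
total radial derivative, which integrates to the value at the origin, and of a total angular
derivative, which integrates to zero. -/
theorem integral_inv_smul_dbar [CompleteSpace F] {f : ℂ → F} (hf : ContDiff ℝ 1 f)
    (hc : HasCompactSupport f) :
    ∫ ζ, ζ⁻¹ • dbar f ζ = -((2 * π) • f 0) := by
  obtain ⟨R, hR⟩ : ∃ R : ℝ, tsupport f ⊆ closedBall 0 R :=
    hc.isCompact.isBounded.subset_closedBall 0
  set u : ℝ × ℝ → ℂ := fun p => p.1 * Complex.exp (p.2 * Complex.I) with hu
  have huc : Continuous u := by fun_prop
  have hnu : ∀ p : ℝ × ℝ, ‖u p‖ = |p.1| := fun p => by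
    simp [hu, Complex.norm_exp_ofReal_mul_I]
  have hD : Continuous (fderiv ℝ f) := hf.continuous_fderiv one_ne_zero
  have hz : ∀ p : ℝ × ℝ, R < p.1 → fderiv ℝ f (u p) = 0 := by
    intro p hp
    refine image_eq_zero_of_notMem_tsupport fun h => ?_
    have := hR (tsupport_fderiv_subset ℝ h)
    rw [mem_closedBall_zero_iff, hnu] at this
    linarith [le_abs_self p.1]
  -- the radial and the angular derivative (the latter divided by the radius)
  set A : ℝ × ℝ → F := fun p => fderiv ℝ f (u p) (Complex.exp (p.2 * Complex.I)) with hA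
  set B : ℝ × ℝ → F := fun p =>
    fderiv ℝ f (u p) (Complex.I * Complex.exp (p.2 * Complex.I)) with hB
  have hAc : Continuous A := (hD.comp huc).clm_apply (by fun_prop)
  have hBc : Continuous B := (hD.comp huc).clm_apply (by fun_prop)
  have hAi := integrable_polar_of_continuous hAc (R := R) fun p hp => by simp [hA, hz p hp]
  have hBi := integrable_polar_of_continuous hBc (R := R) fun p hp => by simp [hB, hz p hp]
  have hdiff : Differentiable ℝ f := hf.differentiable one_ne_zero
  have key : ∀ p ∈ polarCoord.target, p.1 • ((Complex.polarCoord.symm p)⁻¹ •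
      dbar f (Complex.polarCoord.symm p)) = A p + Complex.I • B p := by
    rintro ⟨r, φ⟩ ⟨hr, -⟩
    have hr0 : (r : ℂ) ≠ 0 := by exact_mod_cast (ne_of_gt hr)
    have e1 : Complex.polarCoord.symm (r, φ) = u (r, φ) := by
      rw [Complex.polarCoord_symm_apply, hu]
      simp only [Complex.exp_mul_I, Complex.ofReal_cos, Complex.ofReal_sin]
    rw [e1]
    have e2 : (r : ℝ) • ((u (r, φ))⁻¹ • dbar f (u (r, φ))) =
        Complex.exp (-(φ * Complex.I)) • dbar f (u (r, φ)) := by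
      rw [← Complex.coe_smul, smul_smul, hu]
      congr 1
      simp only [mul_inv, ← Complex.exp_neg]
      field_simp
    have e3 : Complex.exp (φ * Complex.I) = (Real.cos φ) • (1 : ℂ) + (Real.sin φ) • Complex.I := by
      rw [Complex.exp_mul_I]; simp
    have e4 : Complex.I * Complex.exp (φ * Complex.I) =
        (-Real.sin φ) • (1 : ℂ) + (Real.cos φ) • Complex.I := by
      rw [Complex.exp_mul_I]
      simp only [Complex.real_smul, Complex.ofReal_neg, Complex.ofReal_sin, Complex.ofReal_cos]
      linear_combination Complex.sin φ * Complex.I_mul_I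
    have e5 : Complex.exp (-(φ * Complex.I)) =
        ((Real.cos φ : ℝ) : ℂ) - ((Real.sin φ : ℝ) : ℂ) * Complex.I := by
      rw [← neg_mul, Complex.exp_mul_I]; simp [sub_eq_add_neg]
    change r • ((u (r, φ))⁻¹ • dbar f (u (r, φ))) = _
    rw [e2, hA, hB]
    simp only
    rw [e4, e3, e5, map_add, map_add, map_smul, map_smul, map_smul, map_smul, dbar]
    simp only [← Complex.coe_smul]
    match_scalars
    · ring
    · linear_combination -(Complex.sin φ) * Complex.I_mul_I
  have inner1 : ∀ φ : ℝ, ∫ r in Ioi (0 : ℝ), A (r, φ) = - f 0 := by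
    intro φ
    have hlin : ∀ r : ℝ, HasDerivAt (fun r : ℝ => u (r, φ)) (Complex.exp (φ * Complex.I)) r := by
      intro r
      simpa using (Complex.ofRealCLM.hasDerivAt (x := r)).mul_const (Complex.exp (φ * Complex.I))
    have hder : ∀ r : ℝ, HasDerivAt (fun r : ℝ => f (u (r, φ))) (A (r, φ)) r := fun r =>
      (hdiff (u (r, φ))).hasFDerivAt.comp_hasDerivAt r (hlin r)
    have h1 : ContDiff ℝ 1 (fun r : ℝ => f (u (r, φ))) :=
      by
      have h0 : ContDiff ℝ 1 (fun r : ℝ => (r : ℂ) * Complex.exp (φ * Complex.I)) :=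
        (Complex.ofRealCLM.contDiff).mul contDiff_const
      exact hf.comp h0
    have h2 : HasCompactSupport (fun r : ℝ => f (u (r, φ))) := by
      refine HasCompactSupport.intro (isCompact_Icc (a := -R) (b := R)) fun r hr => ?_
      refine image_eq_zero_of_notMem_tsupport fun h => hr ?_
      have := hR h
      rw [mem_closedBall_zero_iff, hnu] at this
      exact abs_le.1 this
    have := h2.integral_Ioi_deriv_eq h1 0
    simp only [(hder _).deriv] at this
    rw [this]
    simp [hu]
  have inner2 : ∀ r ∈ Ioi (0 : ℝ), ∫ φ in Ioo (-π) π, B (r, φ) = 0 := by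
    intro r hr
    have hr0 : r ≠ 0 := ne_of_gt hr
    have hlin : ∀ φ : ℝ, HasDerivAt (fun φ : ℝ => u (r, φ))
        (r • (Complex.I * Complex.exp (φ * Complex.I))) φ := by
      intro φ
      have h1 : HasDerivAt (fun φ : ℝ => (φ : ℂ) * Complex.I) Complex.I φ := by
        simpa using (Complex.ofRealCLM.hasDerivAt (x := φ)).mul_const Complex.I
      have h2 := (h1.cexp).const_mul (r : ℂ)
      rw [Complex.real_smul, mul_comm Complex.I]
      exact h2
    have hder : ∀ φ : ℝ, HasDerivAt (fun φ : ℝ => r⁻¹ • f (u (r, φ))) (B (r, φ)) φ := by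
      intro φ
      have h1 := ((hdiff (u (r, φ))).hasFDerivAt.comp_hasDerivAt φ (hlin φ)).const_smul r⁻¹
      rw [map_smul, smul_smul, inv_mul_cancel₀ hr0, one_smul] at h1
      exact h1
    rw [← integral_Ioc_eq_integral_Ioo,
      ← intervalIntegral.integral_of_le (by linarith [Real.pi_pos]),
      intervalIntegral.integral_eq_sub_of_hasDerivAt (fun φ _ => hder φ)
        ((hBc.comp (by fun_prop : Continuous fun φ : ℝ => (r, φ))).intervalIntegrable _ _)]
    have : u (r, π) = u (r, -π) := by
      simp only [hu, Complex.ofReal_neg, neg_mul, Complex.exp_neg, Complex.exp_pi_mul_I]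
      norm_num
    rw [this, sub_self]
  have hBi' : Integrable (fun p => Complex.I • B p)
      ((volume.restrict (Ioi (0 : ℝ))).prod (volume.restrict (Ioo (-π) π))) := hBi.smul _
  rw [← Complex.integral_comp_polarCoord_symm,
    setIntegral_congr_fun (polarCoord.open_target.measurableSet) key, polarCoord_target,
    Measure.volume_eq_prod, ← Measure.prod_restrict, integral_add hAi hBi', integral_smul,
    integral_prod_symm _ hAi, integral_prod _ hBi, setIntegral_congr_fun measurableSet_Ioi inner2]
  simp only [inner1]
  simp only [integral_const, measureReal_restrict_apply MeasurableSet.univ, univ_inter,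
    Real.volume_real_Ioo_of_le (by linarith [Real.pi_pos] : -π ≤ π)]
  simp only [smul_neg, smul_zero, add_zero]
  congr 2
  ring

/-- The Cauchy transform `z ↦ ∫ h(ζ) / (z - ζ) dA(ζ)`. -/
noncomputable def cauchyTransform (h : ℂ → F) (z : ℂ) : F := ∫ ζ, (z - ζ)⁻¹ • h ζ

/-- The Cauchy–Pompeiu formula for compactly supported functions. -/
theorem cauchyTransform_dbar [CompleteSpace F] {f : ℂ → F} (hf : ContDiff ℝ 1 f)
    (hc : HasCompactSupport f) (z : ℂ) :
    cauchyTransform (dbar f) z = (2 * π) • f z := by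
  have h1 : ContDiff ℝ 1 (fun w => f (z + w)) := hf.comp (contDiff_const.add contDiff_id)
  have h2 : HasCompactSupport (fun w => f (z + w)) :=
    hc.comp_homeomorph (Homeomorph.addLeft z)
  have h3 := integral_inv_smul_dbar h1 h2
  have h4 : ∀ w, dbar (fun w => f (z + w)) w = dbar f (z + w) := by
    intro w
    simp only [dbar, fderiv_comp_add_left]
  simp only [h4, add_zero] at h3
  rw [cauchyTransform, ← integral_add_left_eq_self _ z, ← neg_inj, ← h3, ← integral_neg]
  refine integral_congr_ae (Eventually.of_forall fun w => ?_)
  simp only [sub_add_cancel_left, inv_neg, neg_smul, neg_neg]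

/-- The Cauchy transform is holomorphic off the support. -/
theorem differentiableAt_cauchyTransform {h : ℂ → F} (hh : Integrable h) {z₀ : ℂ}
    (hz : ∀ᶠ ζ in 𝓝 z₀, h ζ = 0) : DifferentiableAt ℂ (cauchyTransform h) z₀ := by
  obtain ⟨δ, hδ, hzδ⟩ := Metric.eventually_nhds_iff.1 hz
  have hmeas : ∀ z : ℂ, AEStronglyMeasurable (fun ζ => (z - ζ)⁻¹ • h ζ) := fun z =>
    ((measurable_const.sub measurable_id).inv.aestronglyMeasurable).smul hh.aestronglyMeasurable
  have hfar : ∀ ζ, h ζ ≠ 0 → ∀ z ∈ ball z₀ (δ / 2), δ / 2 ≤ ‖z - ζ‖ := by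
    intro ζ hζ z hz
    have h1 : δ ≤ dist ζ z₀ := not_lt.1 fun h' => hζ (hzδ h')
    have h2 : dist z z₀ < δ / 2 := hz
    have h3 := dist_triangle ζ z z₀
    rw [dist_comm ζ z, dist_eq_norm z ζ] at h3
    linarith
  have hδ2 : 0 < δ / 2 := by positivity
  refine ((hasDerivAt_integral_of_dominated_loc_of_deriv_le (𝕜 := ℂ)
    (F := fun z ζ => (z - ζ)⁻¹ • h ζ) (F' := fun z ζ => (-1 / (z - ζ) ^ 2) • h ζ)
    (bound := fun ζ => (1 / (δ / 2) ^ 2) * ‖h ζ‖) (s := ball z₀ (δ / 2))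
    (ball_mem_nhds _ hδ2) (Eventually.of_forall hmeas) ?_ ?_ ?_ ?_ ?_).2).differentiableAt
  · refine (hh.norm.const_mul (δ / 2)⁻¹).mono' (hmeas z₀) (Eventually.of_forall fun ζ => ?_)
    by_cases hζ : h ζ = 0
    · simp [hζ]
    · rw [norm_smul, norm_inv]
      gcongr
      exact hfar ζ hζ z₀ (mem_ball_self hδ2)
  · refine AEStronglyMeasurable.smul ?_ hh.aestronglyMeasurable
    exact (by fun_prop : Measurable fun ζ : ℂ => -1 / (z₀ - ζ) ^ 2).aestronglyMeasurable
  · refine Eventually.of_forall fun ζ z hzz => ?_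
    by_cases hζ : h ζ = 0
    · simp [hζ]
    · rw [norm_smul, norm_div, norm_neg, norm_one, norm_pow]
      gcongr
      exact hfar ζ hζ z hzz
  · exact hh.norm.const_mul _
  · refine Eventually.of_forall fun ζ z hzz => ?_
    by_cases hζ : h ζ = 0
    · simpa [hζ] using hasDerivAt_const z (0 : F)
    · have hne : z - ζ ≠ 0 := norm_pos_iff.1 (hδ2.trans_le (hfar ζ hζ z hzz))
      exact ((((hasDerivAt_id z).sub_const ζ).fun_inv hne).smul_const (h ζ))

end Pompeiu

/-! ### Integrability of the Cauchy kernel -/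

section Kernel

theorem integrableOn_inv_norm_ball (R : ℝ) :
    IntegrableOn (fun ζ : ℂ => ‖ζ‖⁻¹) (ball 0 R) := by
  refine (integrableOn_fun_norm_addHaar (E := ℂ) volume (f := fun y => y⁻¹)).2 ?_
  have : IntegrableOn (fun _ : ℝ => (1 : ℝ)) (Ioo 0 R) := by simp
  refine this.congr_fun (fun y hy => ?_) measurableSet_Ioo
  simp [Complex.finrank_real_complex, hy.1.ne']

/-- The Cauchy kernel is integrable over a disc, uniformly for poles in the disc. -/
theorem exists_integral_cauchyKernel_le (R : ℝ) : ∃ C : ℝ, 0 ≤ C ∧ ∀ z ∈ ball (0 : ℂ) R,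
    IntegrableOn (fun ζ : ℂ => ‖z - ζ‖⁻¹) (ball 0 R) ∧ ∫ ζ in ball (0 : ℂ) R, ‖z - ζ‖⁻¹ ≤ C := by
  refine ⟨∫ ζ in ball (0 : ℂ) (R + R), ‖ζ‖⁻¹, integral_nonneg fun _ => by positivity,
    fun z hz => ?_⟩
  have h1 : Integrable ((ball (0 : ℂ) (R + R)).indicator fun ζ => ‖ζ‖⁻¹) :=
    (integrable_indicator_iff measurableSet_ball).2 (integrableOn_inv_norm_ball _)
  have h2 := h1.comp_sub_left z
  have hle : ∀ ζ, (ball (0 : ℂ) R).indicator (fun ζ => ‖z - ζ‖⁻¹) ζ ≤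
      (ball (0 : ℂ) (R + R)).indicator (fun ζ => ‖ζ‖⁻¹) (z - ζ) := by
    intro ζ
    by_cases hζ : ζ ∈ ball (0 : ℂ) R
    · rw [indicator_of_mem hζ, indicator_of_mem]
      rw [mem_ball_zero_iff] at *
      exact (norm_sub_le _ _).trans_lt (by linarith)
    · rw [indicator_of_notMem hζ]
      exact indicator_nonneg (fun _ _ => by positivity) _
  have h3 : Integrable ((ball (0 : ℂ) R).indicator fun ζ => ‖z - ζ‖⁻¹) := by
    refine h2.mono' (Measurable.aestronglyMeasurable ?_) (Eventually.of_forall fun ζ => ?_)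
    · exact (by fun_prop : Measurable fun ζ : ℂ => ‖z - ζ‖⁻¹).indicator measurableSet_ball
    · rw [Real.norm_of_nonneg (indicator_nonneg (fun _ _ => by positivity) _)]
      exact hle ζ
  refine ⟨(integrable_indicator_iff measurableSet_ball).1 h3, ?_⟩
  rw [← integral_indicator measurableSet_ball, ← integral_indicator measurableSet_ball,
    ← integral_sub_left_eq_self (fun ζ => (ball (0 : ℂ) (R + R)).indicator (fun ζ => ‖ζ‖⁻¹) ζ)
      volume z]
  exact integral_mono h3 h2 hle

end Kernel

/-! ### Asymptotic expansion of the Cauchy transform and the `∂̄`-equation -/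

section CauchyTransform

theorem integrable_of_bounded_of_support_ball {F : Type*} [NormedAddCommGroup F]
    {R M : ℝ} {h : ℂ → F}
    (hmeas : AEStronglyMeasurable h)
    (hsupp : ∀ ζ, ζ ∉ ball (0 : ℂ) R → h ζ = 0) (hM : ∀ ζ, ‖h ζ‖ ≤ M) : Integrable h := by
  have h1 : Integrable ((ball (0 : ℂ) R).indicator fun _ => M) :=
    (integrable_indicator_iff measurableSet_ball).2 (integrableOn_const measure_ball_lt_top.ne)
  refine h1.mono' hmeas (Eventually.of_forall fun ζ => ?_)
  by_cases hζ : ζ ∈ ball (0 : ℂ) R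
  · rw [indicator_of_mem hζ]
    exact hM ζ
  · rw [indicator_of_notMem hζ, hsupp ζ hζ, norm_zero]

variable {F : Type*} [NormedAddCommGroup F] [NormedSpace ℂ F]

/-- A bounded function supported in a disc stays integrable over the plane when multiplied by the
Cauchy kernel with a pole in that disc. -/
theorem integrable_cauchyKernel_smul {R M : ℝ} {h : ℂ → F} (hmeas : AEStronglyMeasurable h)
    (hsupp : ∀ ζ, ζ ∉ ball (0 : ℂ) R → h ζ = 0) (hM : ∀ ζ, ‖h ζ‖ ≤ M) {z : ℂ}
    (hz : z ∈ ball (0 : ℂ) R) : Integrable (fun ζ => (z - ζ)⁻¹ • h ζ) := by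
  obtain ⟨C, -, hC⟩ := exists_integral_cauchyKernel_le R
  have h1 : Integrable ((ball (0 : ℂ) R).indicator fun ζ => M * ‖z - ζ‖⁻¹) :=
    (integrable_indicator_iff measurableSet_ball).2 ((hC z hz).1.const_mul M)
  refine h1.mono' ?_ (Eventually.of_forall fun ζ => ?_)
  · exact ((measurable_const.sub measurable_id).inv.aestronglyMeasurable).smul hmeas
  · by_cases hζ : ζ ∈ ball (0 : ℂ) R
    · rw [indicator_of_mem hζ, norm_smul, norm_inv, mul_comm]
      gcongr
      exact hM ζ
    · rw [indicator_of_notMem hζ, hsupp ζ hζ, smul_zero, norm_zero]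

/-- Finite geometric expansion of the Cauchy kernel in powers of the pole. -/
theorem cauchyKernel_eq {z ζ : ℂ} (hζ : ζ ≠ 0) (hz : z - ζ ≠ 0) (N : ℕ) :
    (z - ζ)⁻¹ = (∑ n ∈ Finset.range N, z ^ n * -(ζ ^ (n + 1))⁻¹) +
      z ^ N * ((ζ ^ N)⁻¹ * (z - ζ)⁻¹) := by
  induction N with
  | zero => simp
  | succ N ih =>
    refine ih.trans ?_
    rw [Finset.sum_range_succ, add_assoc]
    congr 1
    field_simp
    ring

/-- If `ω` vanishes to infinite order at the origin, its Cauchy transform has an asymptotic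
expansion there, uniformly on the whole disc, with the same bounds
up to a constant factor. -/
theorem exists_cauchyTransform_expansion (R : ℝ) : ∃ C : ℝ, 0 ≤ C ∧
    ∀ (ω : ℂ → F) (m : ℕ → ℝ), AEStronglyMeasurable ω →
      (∀ ζ, ζ ∉ ball (0 : ℂ) R → ω ζ = 0) → (∀ N ζ, ‖ω ζ‖ ≤ m N * ‖ζ‖ ^ N) → (∀ N, 0 ≤ m N) →
      ∃ c : ℕ → F, ∀ N, ∀ z ∈ ball (0 : ℂ) R,
        ‖cauchyTransform ω z - ∑ n ∈ Finset.range N, z ^ n • c n‖ ≤ C * m N * ‖z‖ ^ N := by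
  obtain ⟨C, hC0, hC⟩ := exists_integral_cauchyKernel_le R
  refine ⟨C, hC0, fun ω m hmeas hsupp hb hm => ⟨fun n => ∫ ζ, (-(ζ ^ (n + 1))⁻¹) • ω ζ, ?_⟩⟩
  intro N z hz
  -- the quotients `ζ⁻ⁿ ω` are again bounded and supported in the disc
  have hqm : ∀ n : ℕ, AEStronglyMeasurable (fun ζ => (ζ ^ n)⁻¹ • ω ζ) := fun n =>
    ((measurable_id.pow_const n).inv.aestronglyMeasurable).smul hmeas
  have hqs : ∀ n : ℕ, ∀ ζ, ζ ∉ ball (0 : ℂ) R → (ζ ^ n)⁻¹ • ω ζ = 0 := fun n ζ hζ => by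
    rw [hsupp ζ hζ, smul_zero]
  have hω0 : ω 0 = 0 := by
    have := hb 1 0
    simpa using this
  have hqb : ∀ n : ℕ, ∀ ζ, ‖(ζ ^ n)⁻¹ • ω ζ‖ ≤ m n := fun n ζ => by
    by_cases hζ : ζ = 0
    · rw [hζ, hω0, smul_zero, norm_zero]
      exact hm n
    · have : 0 < ‖ζ‖ ^ n := pow_pos (norm_pos_iff.2 hζ) n
      rw [norm_smul, norm_inv, norm_pow, inv_mul_le_iff₀ this, mul_comm]
      exact hb n ζ
  have hi1 : ∀ n : ℕ, Integrable (fun ζ => z ^ n • (-(ζ ^ (n + 1))⁻¹) • ω ζ) := fun n => by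
    have := (integrable_of_bounded_of_support_ball (hqm (n + 1)) (hqs (n + 1)) (hqb (n + 1))).neg
    simp only [neg_smul]
    exact this.smul (z ^ n)
  have hi2 : Integrable (fun ζ => (z - ζ)⁻¹ • (ζ ^ N)⁻¹ • ω ζ) :=
    integrable_cauchyKernel_smul (hqm N) (hqs N) (hqb N) hz
  have hi2' : Integrable (fun ζ => z ^ N • (z - ζ)⁻¹ • (ζ ^ N)⁻¹ • ω ζ) := hi2.smul (z ^ N)
  have hae : (fun ζ => (z - ζ)⁻¹ • ω ζ) =ᵐ[volume] fun ζ =>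
      (∑ n ∈ Finset.range N, z ^ n • (-(ζ ^ (n + 1))⁻¹) • ω ζ) +
        z ^ N • ((z - ζ)⁻¹ • (ζ ^ N)⁻¹ • ω ζ) := by
    have hne : ∀ᵐ ζ ∂(volume : Measure ℂ), ζ ≠ z := by
      simp [ae_iff, measure_singleton]
    filter_upwards [hne] with ζ hζz
    by_cases hζ : ζ = 0
    · simp [hζ, hω0]
    · conv_lhs => rw [cauchyKernel_eq hζ (sub_ne_zero.2 (Ne.symm hζz)) N, add_smul,
        Finset.sum_smul]
      simp only [smul_smul]
      congr 2
      rw [mul_comm (z - ζ)⁻¹]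
  have heq : cauchyTransform ω z - ∑ n ∈ Finset.range N, z ^ n • ∫ ζ, (-(ζ ^ (n + 1))⁻¹) • ω ζ =
      z ^ N • ∫ ζ, (z - ζ)⁻¹ • (ζ ^ N)⁻¹ • ω ζ := by
    rw [cauchyTransform, integral_congr_ae hae,
      integral_add (integrable_finsetSum _ fun n _ => hi1 n) hi2',
      integral_finsetSum _ fun n _ => hi1 n]
    simp only [integral_smul, add_sub_cancel_left]
  rw [heq, norm_smul, norm_pow, mul_comm]
  gcongr
  have hi3 : Integrable ((ball (0 : ℂ) R).indicator fun ζ => m N * ‖z - ζ‖⁻¹) :=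
    (integrable_indicator_iff measurableSet_ball).2 ((hC z hz).1.const_mul (m N))
  calc ‖∫ ζ, (z - ζ)⁻¹ • (ζ ^ N)⁻¹ • ω ζ‖
      ≤ ∫ ζ, (ball (0 : ℂ) R).indicator (fun ζ => m N * ‖z - ζ‖⁻¹) ζ := by
        refine norm_integral_le_of_norm_le hi3 (Eventually.of_forall fun ζ => ?_)
        by_cases hζ : ζ ∈ ball (0 : ℂ) R
        · rw [indicator_of_mem hζ, norm_smul, norm_inv, mul_comm]
          gcongr
          exact hqb N ζ
        · rw [indicator_of_notMem hζ, hqs N ζ hζ, smul_zero, norm_zero]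
    _ ≤ C * m N := by
        rw [integral_indicator measurableSet_ball, integral_const_mul, mul_comm]
        gcongr
        · exact hm N
        · exact (hC z hz).2

/-- The Cauchy transform solves the `∂̄`-equation: if `∂̄ψ = ω` on an open subset of the disc, then
`ψ` minus the normalized Cauchy transform of `ω` is holomorphic there. Near a point, the
Cauchy–Pompeiu formula for a cut-off of `ψ` exhibits the difference as the Cauchy transform of a
function vanishing near that point. -/
theorem differentiableOn_sub_cauchyTransform [CompleteSpace F] {R M : ℝ} {ω ψ : ℂ → F} {V : Set ℂ}
    (hV : IsOpen V) (hVR : V ⊆ ball 0 R) (hψ : ContDiffOn ℝ 1 ψ V)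
    (hmeas : AEStronglyMeasurable ω) (hsupp : ∀ ζ, ζ ∉ ball (0 : ℂ) R → ω ζ = 0)
    (hM : ∀ ζ, ‖ω ζ‖ ≤ M) (hω : ∀ z ∈ V, dbar ψ z = ω z) :
    DifferentiableOn ℂ (fun z => ψ z - (2 * π)⁻¹ • cauchyTransform ω z) V := by
  intro z₀ hz₀
  obtain ⟨r, hr, hrV⟩ := Metric.nhds_basis_closedBall.mem_iff.1 (hV.mem_nhds hz₀)
  let χ : ContDiffBump z₀ := ⟨r / 2, r, by positivity, by linarith⟩
  set f : ℂ → F := fun z => χ z • ψ z with hf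
  have hts : tsupport f ⊆ closedBall z₀ r := by
    refine (tsupport_smul_subset_left (fun z => χ z) ψ).trans ?_
    exact χ.tsupport_eq.subset
  have hfc : HasCompactSupport f :=
    (isCompact_closedBall z₀ r).of_isClosed_subset (isClosed_tsupport f) hts
  have hf1 : ContDiff ℝ 1 f := by
    refine contDiff_iff_contDiffAt.2 fun x => ?_
    by_cases hx : x ∈ tsupport f
    · exact (χ.contDiff.contDiffAt).smul (hψ.contDiffAt (hV.mem_nhds (hrV (hts hx))))
    · exact contDiffAt_const.congr_of_eventuallyEq (notMem_tsupport_iff_eventuallyEq.1 hx)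
  have hdc : Continuous (dbar f) := continuousOn_univ.1
    (continuousOn_dbar isOpen_univ hf1.contDiffOn)
  have hds : ∀ ζ, ζ ∉ tsupport f → dbar f ζ = 0 := fun ζ hζ => by
    have : fderiv ℝ f ζ = 0 :=
      image_eq_zero_of_notMem_tsupport fun h => hζ (tsupport_fderiv_subset ℝ h)
    simp [dbar, this]
  obtain ⟨M', hM'⟩ := (HasCompactSupport.intro hfc.isCompact hds).exists_bound_of_continuous hdc
  have hdR : ∀ ζ, ζ ∉ ball (0 : ℂ) R → dbar f ζ = 0 := fun ζ hζ =>
    hds ζ fun h => hζ (hVR (hrV (hts h)))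
  have hnear : f =ᶠ[𝓝 z₀] ψ := by
    filter_upwards [χ.eventuallyEq_one] with z hz
    simp [hf, hz]
  have h0 : ∀ᶠ ζ in 𝓝 z₀, dbar f ζ - ω ζ = 0 := by
    filter_upwards [hnear.eventuallyEq_nhds, hV.mem_nhds hz₀] with ζ h1 h2
    rw [dbar_congr h1, hω ζ h2, sub_self]
  have hint : Integrable (fun ζ => dbar f ζ - ω ζ) :=
    (integrable_of_bounded_of_support_ball hdc.aestronglyMeasurable hdR hM').sub
      (integrable_of_bounded_of_support_ball hmeas hsupp hM)
  have hT := (differentiableAt_cauchyTransform hint h0).const_smul (2 * π)⁻¹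
  refine (hT.congr_of_eventuallyEq ?_).differentiableWithinAt
  filter_upwards [hnear, hV.mem_nhds hz₀] with z hz hzV
  have hzR := hVR hzV
  have e1 : cauchyTransform (fun ζ => dbar f ζ - ω ζ) z =
      cauchyTransform (dbar f) z - cauchyTransform ω z := by
    simp only [cauchyTransform, smul_sub]
    exact integral_sub (integrable_cauchyKernel_smul hdc.aestronglyMeasurable hdR hM' hzR)
      (integrable_cauchyKernel_smul hmeas hsupp hM hzR)
  have hpi : (2 * π) ≠ 0 := by positivity
  simp only [Pi.smul_apply]
  rw [e1, cauchyTransform_dbar hf1 hfc, hz, smul_sub, smul_smul, inv_mul_cancel₀ hpi, one_smul]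

end CauchyTransform

/-! ### Conic coverings and partitions of unity -/

section Covering

/-- A covering of a punctured disc by open sets which are invariant under those positive homotheties
that do not leave the disc. -/
structure IsConicCovering {ι : Type*} (ε₀ : ℝ) (E : ι → Set ℂ) : Prop where
  radius_pos : 0 < ε₀
  isOpen : ∀ i, IsOpen (E i)
  union : ⋃ i, E i = ball 0 ε₀ \ {0}
  smul_mem : ∀ i, ∀ z ∈ E i, ∀ t : ℝ, 0 < t → ‖t • z‖ < ε₀ → t • z ∈ E i

namespace IsConicCovering

variable {ι : Type*} {ε₀ : ℝ} {E : ι → Set ℂ}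

theorem subset_ball (hE : IsConicCovering ε₀ E) (i : ι) : E i ⊆ ball 0 ε₀ := fun z hz => by
  have : z ∈ ⋃ i, E i := mem_iUnion.2 ⟨i, hz⟩
  rw [hE.union] at this
  exact this.1

theorem ne_zero (hE : IsConicCovering ε₀ E) {i : ι} {z : ℂ} (hz : z ∈ E i) : z ≠ 0 := by
  have : z ∈ ⋃ i, E i := mem_iUnion.2 ⟨i, hz⟩
  rw [hE.union] at this
  exact this.2

theorem exists_mem (hE : IsConicCovering ε₀ E) {z : ℂ} (h0 : z ≠ 0) (hz : ‖z‖ < ε₀) :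
    ∃ i, z ∈ E i := by
  have : z ∈ ⋃ i, E i := by
    rw [hE.union]
    exact ⟨mem_ball_zero_iff.2 hz, h0⟩
  exact mem_iUnion.1 this

/-- A conic covering admits a subordinate partition of unity which is homogeneous of degree zero,
so that its gradients are `O(1 / |z|)`. It is obtained by radial extension from a circle. -/
theorem exists_partition [Fintype ι] (hE : IsConicCovering ε₀ E) :
    ∃ (θ : ι → ℂ → ℝ) (D : ℝ), 0 ≤ D ∧
      (∀ l, ∀ z ≠ 0, ContDiffAt ℝ 1 (θ l) z) ∧
      (∀ l z, 0 ≤ θ l z) ∧ (∀ z ≠ 0, ∑ l, θ l z = 1) ∧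
      (∀ l, ∀ z ≠ 0, ‖z‖ < ε₀ → z ∉ E l → ∀ᶠ w in 𝓝 z, θ l w = 0) ∧
      (∀ l, ∀ z ≠ 0, ‖fderiv ℝ (θ l) z‖ ≤ D / ‖z‖) := by
  set ρ : ℝ := ε₀ / 2 with hρ
  have hε := hE.radius_pos
  have hρ0 : 0 < ρ := by positivity
  have hcov : sphere (0 : ℂ) ρ ⊆ ⋃ i, E i := by
    intro z hz
    rw [mem_sphere_zero_iff_norm] at hz
    obtain ⟨i, hi⟩ := hE.exists_mem (z := z) (norm_pos_iff.1 (by rw [hz]; exact hρ0))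
      (by rw [hz]; linarith)
    exact mem_iUnion.2 ⟨i, hi⟩
  obtain ⟨f, hf⟩ := SmoothPartitionOfUnity.exists_isSubordinate (modelWithCornersSelf ℝ ℂ)
    (isClosed_sphere (x := (0 : ℂ)) (ε := ρ)) E hE.isOpen hcov
  -- the radial projection to the circle of radius `ρ`
  set p : ℂ → ℂ := fun z => (ρ * ‖z‖⁻¹) • z with hp
  have hpn : ∀ z ≠ 0, ‖p z‖ = ρ := fun z hz => by
    have : ‖z‖ ≠ 0 := norm_ne_zero_iff.2 hz
    rw [hp, norm_smul, norm_mul, norm_inv, norm_norm, Real.norm_of_nonneg hρ0.le]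
    field_simp
  have hpd : ∀ z ≠ 0, ContDiffAt ℝ 1 p z := fun z hz =>
    (contDiffAt_const.mul ((contDiffAt_norm ℝ hz).inv (norm_ne_zero_iff.2 hz))).smul contDiffAt_id
  have hfd : ∀ l, ContDiff ℝ 1 (fun z => f l z) := fun l =>
    ((f l).contMDiff.contDiff).of_le (by exact_mod_cast le_top)
  have hsc : ∀ t : ℝ, 0 < t → ∀ z, p (t • z) = p z := fun t ht z => by
    simp only [hp, norm_smul, Real.norm_of_nonneg ht.le, smul_smul]
    congr 1
    field_simp
  have hθd : ∀ l, ∀ z ≠ 0, ContDiffAt ℝ 1 (fun z => f l (p z)) z := fun l z hz =>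
    (hfd l).contDiffAt.comp z (hpd z hz)
  have hbd : ∀ l, ∃ D : ℝ, ∀ z ∈ sphere (0 : ℂ) ρ, ‖fderiv ℝ (fun z => f l (p z)) z‖ ≤ D :=
    fun l => (isCompact_sphere (0 : ℂ) ρ).exists_bound_of_continuousOn fun z hz =>
      ((hθd l z (ne_zero_of_mem_sphere hρ0.ne' ⟨z, hz⟩)).continuousAt_fderiv
        one_ne_zero).continuousWithinAt
  choose D hD using hbd
  refine ⟨fun l z => f l (p z), ρ * ∑ l, |D l|, by positivity, hθd, fun l z => f.nonneg l _,
    fun z hz => ?_, fun l z hz hzε hzE => ?_, fun l z hz => ?_⟩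
  · have := f.sum_eq_one (mem_sphere_zero_iff_norm.2 (hpn z hz))
    rwa [finsum_eq_sum_of_fintype] at this
  · have hpE : p z ∉ tsupport (f l) := by
      intro h
      have h1 := hf l h
      have hz0 : 0 < ‖z‖ := norm_pos_iff.2 hz
      have h2 : (ρ * ‖z‖⁻¹)⁻¹ • p z = z := by
        rw [hp, smul_smul, inv_mul_cancel₀ (by positivity), one_smul]
      have h3 := hE.smul_mem l _ h1 (ρ * ‖z‖⁻¹)⁻¹ (by positivity)
      rw [h2] at h3
      exact hzE (h3 hzε)
    exact (hpd z hz).continuousAt.eventually (notMem_tsupport_iff_eventuallyEq.1 hpE)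
  · have hz0 : 0 < ‖z‖ := norm_pos_iff.2 hz
    set t : ℝ := ρ * ‖z‖⁻¹ with ht
    have ht0 : 0 < t := by positivity
    have h1 : (fun w => f l (p w)) = fun w => f l (p (t • w)) := by
      funext w
      rw [hsc t ht0]
    have h2 := fderiv_comp_smul (𝕜 := ℝ) (f := fun w => f l (p w)) (x := z) t
    rw [← h1] at h2
    rw [h2, norm_smul, Real.norm_of_nonneg ht0.le, ht, div_eq_mul_inv, mul_assoc, mul_assoc,
      mul_comm (∑ l, |D l|)]
    have h3 := hD l (p z) (mem_sphere_zero_iff_norm.2 (hpn z hz))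
    gcongr
    exact h3.trans ((le_abs_self _).trans
      (Finset.single_le_sum (f := fun l => |D l|) (fun _ _ => abs_nonneg _) (Finset.mem_univ l)))

end IsConicCovering

end Covering

/-! ### Splitting flat cocycles -/

section Splitting

variable {F : Type*} [NormedAddCommGroup F] [NormedSpace ℂ F] [CompleteSpace F]

/-- A flat holomorphic cocycle on a conic covering of a punctured disc is the coboundary of
holomorphic functions which share one asymptotic expansion at the origin; the remainders are
controlled by the flatness constants `m` of the cocycle. A partition of unity splits the cocycle
by smooth functions `ψ i`, whose `∂̄`-derivatives glue to a flat `(0, 1)`-form `ω`; subtracting the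
Cauchy transform of `ω` makes them holomorphic. -/
theorem IsConicCovering.exists_holomorphic_splitting {ι : Type*} [Fintype ι] {ε₀ : ℝ}
    {E : ι → Set ℂ} (hE : IsConicCovering ε₀ E) (δ : ι → ι → ℂ → F) (m : ℕ → ℝ)
    (hδ : ∀ i j, DifferentiableOn ℂ (δ i j) (E i ∩ E j))
    (hcoc : ∀ i j l, ∀ z ∈ E i, z ∈ E j → z ∈ E l → δ i j z + δ j l z = δ i l z)
    (hm0 : ∀ N, 0 ≤ m N)
    (hm : ∀ i j N, ∀ z ∈ E i, z ∈ E j → ‖δ i j z‖ ≤ m N * ‖z‖ ^ N) :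
    ∃ (Ψ : ι → ℂ → F) (c : ℕ → F) (C : ℝ), 0 ≤ C ∧
      (∀ i, DifferentiableOn ℂ (Ψ i) (E i)) ∧
      (∀ i j, ∀ z ∈ E i, z ∈ E j → Ψ j z - Ψ i z = δ i j z) ∧
      ∀ i N, ∀ z ∈ E i, ‖Ψ i z - ∑ n ∈ Finset.range N, z ^ n • c n‖ ≤
        C * (m N + m (N + 1)) * ‖z‖ ^ N := by
  classical
  obtain ⟨θ, D, hD0, hθd, hθ0, hθ1, hθE, hθD⟩ := hE.exists_partition
  have hθz : ∀ l, ∀ z ≠ 0, ‖z‖ < ε₀ → z ∉ E l → θ l z = 0 := fun l z h0 h1 h2 =>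
    (hθE l z h0 h1 h2).self_of_nhds
  have hnorm : ∀ {i z}, z ∈ E i → ‖z‖ < ε₀ := fun hz =>
    mem_ball_zero_iff.1 (hE.subset_ball _ hz)
  have hθle : ∀ l, ∀ z ≠ 0, θ l z ≤ 1 := fun l z hz => by
    rw [← hθ1 z hz]
    exact Finset.single_le_sum (f := fun l => θ l z) (fun l _ => hθ0 l z) (Finset.mem_univ l)
  set ψ : ι → ℂ → F := fun i z => ∑ l, θ l z • δ l i z with hψ
  -- the summands of `ψ i` are smooth on `E i`: off `E l` the factor `θ l` vanishes locally
  have hterm : ∀ i l, ∀ z ∈ E i, ContDiffAt ℝ 1 (fun w => θ l w • δ l i w) z := by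
    intro i l z hz
    by_cases hl : z ∈ E l
    · have h1 : ContDiffAt ℂ 1 (δ l i) z :=
        ((hδ l i).contDiffOn ((hE.isOpen l).inter (hE.isOpen i))).contDiffAt
          (((hE.isOpen l).inter (hE.isOpen i)).mem_nhds ⟨hl, hz⟩)
      exact (hθd l z (hE.ne_zero hz)).smul (h1.restrict_scalars ℝ)
    · refine (contDiffAt_const (c := (0 : F))).congr_of_eventuallyEq ?_
      filter_upwards [hθE l z (hE.ne_zero hz) (hnorm hz) hl] with w hw
      rw [hw, zero_smul]
  have hdterm : ∀ i l N, ∀ z ∈ E i,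
      ‖dbar (fun w => θ l w • δ l i w) z‖ ≤ 2 * D * m (N + 1) * ‖z‖ ^ N := by
    intro i l N z hz
    have hz0 : 0 < ‖z‖ := norm_pos_iff.2 (hE.ne_zero hz)
    by_cases hl : z ∈ E l
    · have h1 : DifferentiableAt ℂ (δ l i) z := (hδ l i).differentiableAt
          (((hE.isOpen l).inter (hE.isOpen i)).mem_nhds ⟨hl, hz⟩)
      calc _ ≤ 2 * ‖fderiv ℝ (θ l) z‖ * ‖δ l i z‖ :=
            norm_dbar_smul_le ((hθd l z (hE.ne_zero hz)).differentiableAt one_ne_zero) h1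
        _ ≤ 2 * (D / ‖z‖) * (m (N + 1) * ‖z‖ ^ (N + 1)) := by
            gcongr
            · exact hθD l z (hE.ne_zero hz)
            · exact hm l i (N + 1) z hl hz
        _ = _ := by
            field_simp
            ring
    · have h1 : (fun w => θ l w • δ l i w) =ᶠ[𝓝 z] fun _ => (0 : F) := by
        filter_upwards [hθE l z (hE.ne_zero hz) (hnorm hz) hl] with w hw
        rw [hw, zero_smul]
      rw [dbar_congr h1, dbar_eq_zero (differentiableAt_const _), norm_zero]
      have := hm0 (N + 1)
      positivity
  have hψ1 : ∀ i, ∀ z ∈ E i, ContDiffAt ℝ 1 (ψ i) z := fun i z hz =>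
    ContDiffAt.sum fun l _ => hterm i l z hz
  have hψd : ∀ i N, ∀ z ∈ E i,
      ‖dbar (ψ i) z‖ ≤ Fintype.card ι * (2 * D) * m (N + 1) * ‖z‖ ^ N := by
    intro i N z hz
    rw [hψ, dbar_sum _ fun l _ => (hterm i l z hz).differentiableAt one_ne_zero]
    refine (norm_sum_le_of_le _ fun l _ => hdterm i l N z hz).trans_eq ?_
    rw [Finset.sum_const, Finset.card_univ, nsmul_eq_mul]
    ring
  have hψb : ∀ i N, ∀ z ∈ E i, ‖ψ i z‖ ≤ Fintype.card ι * m N * ‖z‖ ^ N := by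
    intro i N z hz
    have : ∀ l ∈ Finset.univ, ‖θ l z • δ l i z‖ ≤ m N * ‖z‖ ^ N := by
      intro l _
      by_cases hl : z ∈ E l
      · rw [norm_smul, Real.norm_of_nonneg (hθ0 l z)]
        refine (mul_le_of_le_one_left (norm_nonneg _) (hθle l z (hE.ne_zero hz))).trans ?_
        exact hm l i N z hl hz
      · rw [hθz l z (hE.ne_zero hz) (hnorm hz) hl, zero_smul, norm_zero]
        have := hm0 N
        positivity
    refine (norm_sum_le_of_le _ this).trans_eq ?_
    rw [Finset.sum_const, Finset.card_univ, nsmul_eq_mul]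
    ring
  have hψsub : ∀ i j, ∀ z ∈ E i, z ∈ E j → ψ j z = ψ i z + δ i j z := by
    intro i j z hi hj
    have : δ i j z = ∑ l, θ l z • δ i j z := by
      rw [← Finset.sum_smul, hθ1 z (hE.ne_zero hi), one_smul]
    rw [this, hψ]
    simp only
    rw [← Finset.sum_add_distrib]
    refine Finset.sum_congr rfl fun l _ => ?_
    by_cases hl : z ∈ E l
    · rw [← hcoc l i j z hl hi hj, smul_add]
    · simp [hθz l z (hE.ne_zero hi) (hnorm hi) hl]
  have hglue : ∀ i j, ∀ z ∈ E i, z ∈ E j → dbar (ψ j) z = dbar (ψ i) z := by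
    intro i j z hi hj
    have hev : ψ j =ᶠ[𝓝 z] fun w => ψ i w + δ i j w := by
      filter_upwards [(hE.isOpen i).mem_nhds hi, (hE.isOpen j).mem_nhds hj] with w h1 h2
      exact hψsub i j w h1 h2
    have h1 : DifferentiableAt ℂ (δ i j) z := (hδ i j).differentiableAt
      (((hE.isOpen i).inter (hE.isOpen j)).mem_nhds ⟨hi, hj⟩)
    rw [dbar_congr hev, dbar_add ((hψ1 i z hi).differentiableAt one_ne_zero)
      (h1.restrictScalars ℝ), dbar_eq_zero h1, add_zero]
  set ω : ℂ → F := fun z => if h : ∃ i, z ∈ E i then dbar (ψ h.choose) z else 0 with hω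
  have hωE : ∀ i, ∀ z ∈ E i, dbar (ψ i) z = ω z := by
    intro i z hz
    have h : ∃ i, z ∈ E i := ⟨i, hz⟩
    rw [hω]
    simp only [h, dif_pos]
    exact hglue _ _ z h.choose_spec hz
  have hω0 : ∀ z, (∀ i, z ∉ E i) → ω z = 0 := fun z hz =>
    dif_neg fun ⟨i, hi⟩ => hz i hi
  have hsupp : ∀ z, z ∉ ball (0 : ℂ) ε₀ → ω z = 0 := fun z hz =>
    hω0 z fun i hi => hz (hE.subset_ball i hi)
  set K : ℝ := Fintype.card ι * (2 * D) with hK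
  have hK0 : 0 ≤ K := by positivity
  have hωb : ∀ N z, ‖ω z‖ ≤ K * m (N + 1) * ‖z‖ ^ N := by
    intro N z
    by_cases h : ∃ i, z ∈ E i
    · obtain ⟨i, hi⟩ := h
      rw [← hωE i z hi]
      exact hψd i N z hi
    · rw [hω0 z fun i hi => h ⟨i, hi⟩, norm_zero]
      have := hm0 (N + 1)
      positivity
  have hmeas : AEStronglyMeasurable ω := by
    have hS : MeasurableSet (⋃ i, E i) := (isOpen_iUnion hE.isOpen).measurableSet
    have h1 : ContinuousOn ω (⋃ i, E i) := by
      intro z hz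
      obtain ⟨i, hi⟩ := mem_iUnion.1 hz
      have h2 : ContinuousAt (dbar (ψ i)) z :=
        (continuousOn_dbar (hE.isOpen i)
          (fun w hw => (hψ1 i w hw).contDiffWithinAt)).continuousAt ((hE.isOpen i).mem_nhds hi)
      refine (h2.congr ?_).continuousWithinAt
      filter_upwards [(hE.isOpen i).mem_nhds hi] with w hw
      exact hωE i w hw
    have h2 : (⋃ i, E i).indicator ω = ω := by
      refine indicator_eq_self.2 fun z hz => ?_
      by_contra h
      exact hz (hω0 z fun i hi => h (mem_iUnion.2 ⟨i, hi⟩))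
    rw [← h2, aestronglyMeasurable_indicator_iff hS]
    exact h1.aestronglyMeasurable hS
  have hωM : ∀ z, ‖ω z‖ ≤ K * m 1 := fun z => by simpa using hωb 0 z
  obtain ⟨C, hC0, hC⟩ := exists_cauchyTransform_expansion (F := F) ε₀
  obtain ⟨c, hc⟩ := hC ω (fun N => K * m (N + 1)) hmeas hsupp hωb
    fun N => mul_nonneg hK0 (hm0 _)
  refine ⟨fun i z => ψ i z - (2 * π)⁻¹ • cauchyTransform ω z, fun n => -((2 * π)⁻¹ • c n),
    Fintype.card ι + (2 * π)⁻¹ * (C * K), by positivity, fun i => ?_, fun i j z hi hj => ?_,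
    fun i N z hz => ?_⟩
  · exact differentiableOn_sub_cauchyTransform (hE.isOpen i) (hE.subset_ball i)
      (fun w hw => (hψ1 i w hw).contDiffWithinAt) hmeas hsupp hωM (hωE i)
  · simp only [hψsub i j z hi hj]
    abel
  · have e1 : ψ i z - (2 * π)⁻¹ • cauchyTransform ω z -
        ∑ n ∈ Finset.range N, z ^ n • -((2 * π)⁻¹ • c n) =
        ψ i z - (2 * π)⁻¹ • (cauchyTransform ω z - ∑ n ∈ Finset.range N, z ^ n • c n) := by
      simp only [smul_neg, Finset.sum_neg_distrib, smul_sub, Finset.smul_sum,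
        smul_comm _ ((2 * π)⁻¹ : ℝ)]
      abel
    have h1 := hψb i N z hz
    have h2 := hc N z (hE.subset_ball i hz)
    have hm1 := hm0 N
    have hm2 := hm0 (N + 1)
    rw [e1]
    calc _ ≤ Fintype.card ι * m N * ‖z‖ ^ N + (2 * π)⁻¹ * (C * (K * m (N + 1)) * ‖z‖ ^ N) := by
          refine (norm_sub_le _ _).trans (add_le_add h1 ?_)
          rw [norm_smul, Real.norm_of_nonneg (by positivity)]
          gcongr
      _ ≤ _ := by
          have h3 : 0 ≤ (Fintype.card ι : ℝ) * m (N + 1) * ‖z‖ ^ N := by positivity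
          have h4 : 0 ≤ (2 * π)⁻¹ * (C * K) * m N * ‖z‖ ^ N := by positivity
          linear_combination h3 + h4

end Splitting

/-! ### Sectors and good coverings -/

section Sectors

theorem openSector_subset_ball (a b r : ℝ) : openSector a b r ⊆ ball 0 r := by
  rintro z ⟨ρ, φ, h0, h1, -, -, rfl⟩
  rw [mem_ball_zero_iff, norm_mul, Complex.norm_exp_ofReal_mul_I, mul_one, Complex.norm_real,
    Real.norm_of_nonneg h0.le]
  exact h1

theorem isOpen_openSector (a b : ℝ) {r : ℝ} (hr : 0 < r) : IsOpen (openSector a b r) := by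
  have h : openSector a b r =
      Complex.exp '' ({w | w.re < Real.log r} ∩ {w | a < w.im} ∩ {w | w.im < b}) := by
    ext z
    constructor
    · rintro ⟨ρ, φ, h0, h1, h2, h3, rfl⟩
      refine ⟨Real.log ρ + φ * Complex.I, ?_, ?_⟩
      · simpa using ⟨⟨Real.log_lt_log h0 h1, h2⟩, h3⟩
      · rw [Complex.exp_add, ← Complex.ofReal_exp, Real.exp_log h0]
    · rintro ⟨w, ⟨⟨h1, h2⟩, h3⟩, rfl⟩
      refine ⟨Real.exp w.re, w.im, Real.exp_pos _, ?_, h2, h3, ?_⟩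
      · exact (Real.lt_log_iff_exp_lt hr).1 h1
      · rw [Complex.ofReal_exp, ← Complex.exp_add, Complex.re_add_im]
  rw [h]
  refine Complex.isOpenMap_exp _ ?_
  exact ((isOpen_lt Complex.continuous_re continuous_const).inter
    (isOpen_lt continuous_const Complex.continuous_im)).inter
    (isOpen_lt Complex.continuous_im continuous_const)

theorem smul_mem_openSector {a b r : ℝ} {z : ℂ} (hz : z ∈ openSector a b r) {t : ℝ} (ht : 0 < t)
    (h : ‖t • z‖ < r) : t • z ∈ openSector a b r := by
  obtain ⟨ρ, φ, h0, h1, h2, h3, rfl⟩ := hz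
  refine ⟨t * ρ, φ, by positivity, ?_, h2, h3, ?_⟩
  · rwa [norm_smul, norm_mul, Complex.norm_exp_ofReal_mul_I, mul_one, Complex.norm_real,
      Real.norm_of_nonneg h0.le, Real.norm_of_nonneg ht.le] at h
  · rw [Complex.real_smul]
    push_cast
    ring

theorem IsGoodCovering.isConicCovering {ι : Type*} {ε₀ : ℝ} {E : ι → Set ℂ}
    (hE : IsGoodCovering ε₀ E) : IsConicCovering ε₀ E := by
  obtain ⟨U, hU, hEU⟩ := hE.union
  have hball : ∀ i, E i ⊆ ball 0 ε₀ := fun i => by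
    obtain ⟨a, b, -, -, h⟩ := hE.sector i
    rw [h]
    exact openSector_subset_ball a b ε₀
  have hsmul : ∀ i, ∀ z ∈ E i, ∀ t : ℝ, 0 < t → ‖t • z‖ < ε₀ → t • z ∈ E i := by
    intro i z hz t ht h
    obtain ⟨a, b, -, -, hi⟩ := hE.sector i
    rw [hi] at hz ⊢
    exact smul_mem_openSector hz ht h
  refine ⟨hE.radius_pos, fun i => ?_, ?_, hsmul⟩
  · obtain ⟨a, b, -, -, h⟩ := hE.sector i
    rw [h]
    exact isOpen_openSector a b hE.radius_pos
  · refine Subset.antisymm (fun z hz => ⟨?_, ?_⟩) ?_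
    · obtain ⟨i, hi⟩ := mem_iUnion.1 hz
      exact hball i hi
    · rw [hEU] at hz
      exact hz.2
    · rintro z ⟨hz, hz0⟩
      rw [mem_ball_zero_iff] at hz
      obtain ⟨s, hs, hsU⟩ := Metric.mem_nhds_iff.1 hU
      have hz1 : 0 < ‖z‖ := norm_pos_iff.2 hz0
      -- a small positive multiple of `z` lies in the neighbourhood, hence in some sector
      set t : ℝ := s / 2 * ‖z‖⁻¹ with ht
      have ht0 : 0 < t := by positivity
      have h1 : t • z ∈ ⋃ i, E i := by
        rw [hEU]
        refine ⟨hsU ?_, smul_ne_zero ht0.ne' hz0⟩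
        rw [mem_ball_zero_iff, norm_smul, Real.norm_of_nonneg ht0.le, ht, mul_assoc,
          inv_mul_cancel₀ hz1.ne']
        linarith
      obtain ⟨i, hi⟩ := mem_iUnion.1 h1
      have h2 := hsmul i _ hi t⁻¹ (by positivity)
      rw [smul_smul, inv_mul_cancel₀ ht0.ne', one_smul] at h2
      exact mem_iUnion.2 ⟨i, h2 hz⟩

end Sectors

/-! ### Gevrey and `q`-Gevrey moments of flat functions -/

section Flatness

/-- Exponential flatness of order `k` in terms of Gevrey moments. -/
theorem exp_neg_div_pow_le {k : ℕ} (hk : 1 ≤ k) {M t : ℝ} (hM : 0 < M) (ht : 0 < t) (N : ℕ) :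
    Real.exp (-(M / t ^ k)) ≤
      ((M ^ (1 / (k : ℝ)))⁻¹) ^ N * (Nat.factorial N : ℝ) ^ (1 / (k : ℝ)) * t ^ N := by
  have hk0 : k ≠ 0 := by omega
  have hkR : (1 : ℝ) ≤ k := by exact_mod_cast hk
  set x : ℝ := M / t ^ k with hx
  have hx0 : 0 < x := by positivity
  have h1 : x ^ N ≤ Nat.factorial N * Real.exp (k * x) := by
    have h := Real.pow_div_factorial_le_exp x hx0.le N
    rw [div_le_iff₀ (by positivity), mul_comm] at h
    refine h.trans ?_
    gcongr
    nlinarith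
  refine le_of_pow_le_pow_left₀ hk0 (by positivity) ?_
  have e1 : (((M ^ (1 / (k : ℝ)))⁻¹) ^ N * (Nat.factorial N : ℝ) ^ (1 / (k : ℝ)) * t ^ N) ^ k =
      (x ^ N)⁻¹ * Nat.factorial N := by
    have e2 : (M ^ (1 / (k : ℝ))) ^ k = M := by
      rw [one_div]
      exact Real.rpow_inv_natCast_pow hM.le hk0
    have e3 : ((Nat.factorial N : ℝ) ^ (1 / (k : ℝ))) ^ k = Nat.factorial N := by
      rw [one_div]
      exact Real.rpow_inv_natCast_pow (by positivity) hk0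
    rw [mul_pow, mul_pow, e3, ← pow_mul, mul_comm N k, pow_mul, inv_pow, e2, ← pow_mul,
      mul_comm N k, pow_mul, hx, div_pow]
    field_simp
    rw [← mul_pow, one_div_mul_cancel hM.ne', one_pow]
  rw [e1, ← Real.exp_nat_mul, inv_mul_eq_div, le_div_iff₀ (by positivity), mul_neg, Real.exp_neg,
    inv_mul_eq_div, div_le_iff₀ (Real.exp_pos _)]
  exact h1

/-- `q`-exponential flatness of order `κ` in terms of `q`-Gevrey moments, by completing the square
in the exponent. -/
theorem rpow_mul_exp_neg_log_sq_le {q κ : ℝ} (hq : 1 < q) (hκ : 0 < κ) (b : ℝ) {t : ℝ}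
    (ht : 0 < t) (N : ℕ) :
    t ^ b * Real.exp (-(κ / (2 * Real.log q) * Real.log t ^ 2)) ≤
      q ^ (b ^ 2 / (2 * κ)) * (q ^ (-(b / κ))) ^ N * q ^ ((N : ℝ) ^ 2 / (2 * κ)) * t ^ N := by
  have hq0 : 0 < q := by linarith
  have hL : 0 < Real.log q := Real.log_pos hq
  rw [← Real.rpow_natCast (q ^ (-(b / κ))) N, ← Real.rpow_natCast t N, ← Real.rpow_mul hq0.le,
    Real.rpow_def_of_pos ht, Real.rpow_def_of_pos ht, Real.rpow_def_of_pos hq0,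
    Real.rpow_def_of_pos hq0, Real.rpow_def_of_pos hq0, ← Real.exp_add, ← Real.exp_add,
    ← Real.exp_add, ← Real.exp_add, Real.exp_le_exp]
  set s := Real.log t
  set L := Real.log q
  have key : L * (b ^ 2 / (2 * κ)) + L * (-(b / κ) * N) + L * ((N : ℝ) ^ 2 / (2 * κ)) + s * N -
      (s * b + -(κ / (2 * L) * s ^ 2)) = κ / (2 * L) * (s + L * (N - b) / κ) ^ 2 := by
    field_simp
    ring
  have : 0 ≤ κ / (2 * L) * (s + L * (N - b) / κ) ^ 2 := by positivity
  linarith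

theorem natCast_succ_le_two_pow (N : ℕ) : ((N : ℝ) + 1) ≤ 2 ^ N := by
  exact_mod_cast Nat.lt_two_pow_self

/-- Passing from the Gevrey moments of orders `N` and `N + 1` to order `N` costs a geometric
factor. -/
theorem gevrey_moment_add_le {k : ℕ} (hk : 1 ≤ k) {A : ℝ} (hA : 0 ≤ A) (N : ℕ) :
    A ^ N * (Nat.factorial N : ℝ) ^ (1 / (k : ℝ)) +
      A ^ (N + 1) * (Nat.factorial (N + 1) : ℝ) ^ (1 / (k : ℝ)) ≤
      (1 + A) * (2 * A) ^ N * (Nat.factorial N : ℝ) ^ (1 / (k : ℝ)) := by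
  have hkR : (1 : ℝ) ≤ k := by exact_mod_cast hk
  have h2 : (1 : ℝ) ≤ 2 ^ N := one_le_pow₀ one_le_two
  have h1 : ((N : ℝ) + 1) ^ (1 / (k : ℝ)) ≤ 2 ^ N := by
    refine le_trans ?_ (natCast_succ_le_two_pow N)
    refine (Real.rpow_le_rpow_of_exponent_le (by linarith [N.cast_nonneg (α := ℝ)])
      ((div_le_one (by linarith)).2 hkR)).trans_eq (Real.rpow_one _)
  rw [Nat.factorial_succ, Nat.cast_mul, Real.mul_rpow (by positivity) (by positivity), Nat.cast_succ]
  set f := (Nat.factorial N : ℝ) ^ (1 / (k : ℝ)) with hf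
  have hf0 : 0 ≤ f := by positivity
  calc A ^ N * f + A ^ (N + 1) * (((N : ℝ) + 1) ^ (1 / (k : ℝ)) * f)
      ≤ A ^ N * f * 2 ^ N + A ^ (N + 1) * (2 ^ N * f) := by
        refine add_le_add (le_mul_of_one_le_right (by positivity) h2) ?_
        gcongr
    _ = _ := by rw [mul_pow]; ring

/-- The `q`-Gevrey moments of orders `N + 1` and `N + 2` are bounded by the weight
`q ^ ((N + 1) N / (2 κ))` up to a geometric factor. -/
theorem qGevrey_moment_add_le {q κ : ℝ} (hq : 1 < q) (hκ : 0 < κ) {A : ℝ} (hA : 0 ≤ A) (N : ℕ) :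
    A ^ (N + 1) * q ^ (((N + 1 : ℕ) : ℝ) ^ 2 / (2 * κ)) +
      A ^ (N + 2) * q ^ (((N + 2 : ℕ) : ℝ) ^ 2 / (2 * κ)) ≤
      (1 + A) * q ^ (1 / (2 * κ)) * (A * q ^ (3 / (2 * κ))) ^ (N + 1) *
        q ^ ((((N : ℝ) + 1) * (N : ℝ)) / (2 * κ)) := by
  have hq0 : 0 < q := by linarith
  have e : q ^ (((N + 2 : ℕ) : ℝ) ^ 2 / (2 * κ)) =
      q ^ (1 / (2 * κ)) * (q ^ (3 / (2 * κ))) ^ (N + 1) *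
        q ^ ((((N : ℝ) + 1) * (N : ℝ)) / (2 * κ)) := by
    rw [← Real.rpow_natCast (q ^ (3 / (2 * κ))), ← Real.rpow_mul hq0.le, ← Real.rpow_add hq0,
      ← Real.rpow_add hq0]
    congr 1
    push_cast
    field_simp
    ring
  have h : q ^ (((N + 1 : ℕ) : ℝ) ^ 2 / (2 * κ)) ≤ q ^ (((N + 2 : ℕ) : ℝ) ^ 2 / (2 * κ)) := by
    gcongr
    · exact hq.le
    · omega
  calc _ ≤ A ^ (N + 1) * q ^ (((N + 2 : ℕ) : ℝ) ^ 2 / (2 * κ)) +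
      A ^ (N + 2) * q ^ (((N + 2 : ℕ) : ℝ) ^ 2 / (2 * κ)) := by gcongr
    _ = _ := by rw [e, mul_pow]; ring

/-- Finitely many geometric bounds have a common one. -/
theorem exists_uniform_geometric_bound {P : Type*} [Fintype P] {X : P → ℕ → ℝ → Prop}
    (hX : ∀ p N x y, x ≤ y → X p N x → X p N y)
    (h : ∀ p, ∃ K A : ℝ, 0 ≤ K ∧ 0 ≤ A ∧ ∀ N, X p N (K * A ^ N)) :
    ∃ K A : ℝ, 0 ≤ K ∧ 0 < A ∧ ∀ p N, X p N (K * A ^ N) := by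
  choose K A hK hA hb using h
  refine ⟨∑ p, K p, 1 + ∑ p, A p, Finset.sum_nonneg fun p _ => hK p,
    add_pos_of_pos_of_nonneg one_pos (Finset.sum_nonneg fun p _ => hA p), fun p N => ?_⟩
  refine hX p N _ _ ?_ (hb p N)
  have h1 : K p ≤ ∑ p, K p := Finset.single_le_sum (fun p _ => hK p) (Finset.mem_univ p)
  have h2 : A p ≤ ∑ p, A p := Finset.single_le_sum (fun p _ => hA p) (Finset.mem_univ p)
  have h3 := hK p
  have h4 := hA p
  gcongr
  · exact h3.trans h1
  · linarith

end Flatness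

/-! ### Gluing across the origin -/

section Gluing

variable {F : Type*} [NormedAddCommGroup F] [NormedSpace ℂ F] [CompleteSpace F]

/-- Holomorphic functions on a conic covering which agree on overlaps and are bounded near the
origin are the restrictions of the sum of a power series convergent on the full disc. -/
theorem IsConicCovering.exists_hasSum {ι : Type*} [Finite ι] {ε₀ : ℝ} {E : ι → Set ℂ}
    (hE : IsConicCovering ε₀ E) (H : ι → ℂ → F) (hH : ∀ i, DifferentiableOn ℂ (H i) (E i))
    (hglue : ∀ i j, ∀ z ∈ E i, z ∈ E j → H i z = H j z)
    (hbdd : ∀ i, ∃ C ρ : ℝ, 0 < ρ ∧ ∀ z ∈ E i, ‖z‖ < ρ → ‖H i z‖ ≤ C) :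
    ∃ (a : ℂ → F) (c : ℕ → F), (∀ z ∈ ball (0 : ℂ) ε₀, HasSum (fun n => z ^ n • c n) (a z)) ∧
      ∀ i, ∀ z ∈ E i, H i z = a z := by
  classical
  have := Fintype.ofFinite ι
  have hε := hE.radius_pos
  set h : ℂ → F := fun z => if h : ∃ i, z ∈ E i then H h.choose z else 0 with hh
  have hhE : ∀ i, ∀ z ∈ E i, h z = H i z := by
    intro i z hz
    have h' : ∃ i, z ∈ E i := ⟨i, hz⟩
    rw [hh]
    simp only [h', dif_pos]
    exact hglue _ _ z h'.choose_spec hz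
  have hdiff : DifferentiableOn ℂ h (ball 0 ε₀ \ {0}) := by
    intro z hz
    obtain ⟨i, hi⟩ := hE.exists_mem hz.2 (mem_ball_zero_iff.1 hz.1)
    refine (((hH i).differentiableAt ((hE.isOpen i).mem_nhds hi)).congr_of_eventuallyEq
      ?_).differentiableWithinAt
    filter_upwards [(hE.isOpen i).mem_nhds hi] with w hw
    exact hhE i w hw
  choose C ρ hρ hC using hbdd
  have hev : ∀ᶠ z in 𝓝 (0 : ℂ), ∀ i, ‖z‖ < ρ i := by
    refine eventually_all.2 fun i => ?_
    filter_upwards [ball_mem_nhds (0 : ℂ) (hρ i)] with z hz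
    exact mem_ball_zero_iff.1 hz
  obtain ⟨s, hs, hsρ⟩ := Metric.eventually_nhds_iff_ball.1 hev
  set U : Set ℂ := ball 0 (min s ε₀) with hU
  have hU0 : U ∈ 𝓝 (0 : ℂ) := ball_mem_nhds _ (lt_min hs hε)
  have hUε : U ⊆ ball 0 ε₀ := ball_subset_ball (min_le_right _ _)
  have hb : BddAbove (norm ∘ h '' (U \ {0})) := by
    refine ⟨∑ i, |C i|, ?_⟩
    rintro _ ⟨z, ⟨hz, hz0⟩, rfl⟩
    obtain ⟨i, hi⟩ := hE.exists_mem hz0 (mem_ball_zero_iff.1 (hUε hz))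
    have h1 := hC i z hi (hsρ z (ball_subset_ball (min_le_left _ _) hz) i)
    simp only [Function.comp_apply]
    rw [hhE i z hi]
    exact h1.trans ((le_abs_self _).trans
      (Finset.single_le_sum (f := fun i => |C i|) (fun _ _ => abs_nonneg _) (Finset.mem_univ i)))
  set a : ℂ → F := Function.update h 0 (limUnder (𝓝[≠] 0) h) with ha
  have haU : DifferentiableOn ℂ a U :=
    Complex.differentiableOn_update_limUnder_of_bddAbove hU0
      (hdiff.mono (sdiff_subset_sdiff_left hUε)) hb
  have haε : DifferentiableOn ℂ a (ball 0 ε₀) := by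
    refine (Complex.differentiableOn_compl_singleton_and_continuousAt_iff
      (ball_mem_nhds (0 : ℂ) hε)).1 ⟨hdiff.congr fun z hz => ?_, ?_⟩
    · exact Function.update_of_ne hz.2 _ _
    · exact (haU.differentiableAt hU0).continuousAt
  refine ⟨a, fun n => (Nat.factorial n : ℂ)⁻¹ • iteratedDeriv n a 0, fun z hz => ?_,
    fun i z hz => ?_⟩
  · have h1 := Complex.hasSum_taylorSeries_on_ball haε hz
    simp only [sub_zero] at h1
    convert h1 using 2 with n
    exact smul_comm _ _ _
  · rw [ha, Function.update_of_ne (hE.ne_zero hz), hhE i z hz]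

end Gluing

end RamisSibuya

/-! ### The decomposition -/

theorem theorem4 {F : Type*} [NormedAddCommGroup F] [NormedSpace ℂ F] [CompleteSpace F]
    (q : ℝ) (hq : 1 < q) (k : ℕ) (hk : 1 ≤ k) (κ : ℝ) (hκ : 0 < κ)
    (ς : ℕ) (χ : Fin ς → ℕ) (ε₀ : ℝ)
    (E : (p : Fin ς) → Fin (χ p) → Set ℂ)
    (hE : RamisSibuya.IsGoodCovering ε₀ (fun i : (Σ p : Fin ς, Fin (χ p)) => E i.1 i.2))
    (G : (p : Fin ς) → Fin (χ p) → ℂ → F)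
    (hG : ∀ p p₁, DifferentiableOn ℂ (G p p₁) (E p p₁))
    -- each function is bounded as the variable tends to the origin in its sector
    (hbdd : ∀ p p₁, ∃ C ρ : ℝ, 0 < ρ ∧ ∀ ε ∈ E p p₁, ‖ε‖ < ρ → ‖G p p₁ ε‖ ≤ C)
    -- exponential flatness of order k on overlaps with the same p
    (hexp : ∀ (p : Fin ς) (p₁ p₂ : Fin (χ p)), p₁ ≠ p₂ → (E p p₁ ∩ E p p₂).Nonempty →
      ∃ K₁ M₁ : ℝ, 0 < K₁ ∧ 0 < M₁ ∧ ∀ ε ∈ E p p₁ ∩ E p p₂,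
        ‖G p p₂ ε - G p p₁ ε‖ ≤ K₁ * Real.exp (-(M₁ / ‖ε‖ ^ k)))
    -- q-exponential flatness of order κ on overlaps with different p
    (hqexp : ∀ (p p' : Fin ς) (p₁ : Fin (χ p)) (p₂ : Fin (χ p')), p ≠ p' →
      (E p p₁ ∩ E p' p₂).Nonempty →
      ∃ K₂ M₂ : ℝ, 0 < K₂ ∧ ∀ ε ∈ E p p₁ ∩ E p' p₂,
        ‖G p' p₂ ε - G p p₁ ε‖ ≤
          K₂ * ‖ε‖ ^ M₂ * Real.exp (-(κ / (2 * Real.log q) * Real.log ‖ε‖ ^ 2))) :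
    ∃ (a : ℂ → F) (c g₁ g₂ : ℕ → F) (G₁ G₂ : (p : Fin ς) → Fin (χ p) → ℂ → F),
      (∀ ε ∈ Metric.ball (0 : ℂ) ε₀, HasSum (fun n => ε ^ n • c n) (a ε)) ∧
      ∀ (p : Fin ς) (p₁ : Fin (χ p)),
        (∀ ε ∈ E p p₁, G p p₁ ε = a ε + G₁ p p₁ ε + G₂ p p₁ ε) ∧
        DifferentiableOn ℂ (G₁ p p₁) (E p p₁) ∧
        RamisSibuya.HasGevreyExpansion (k : ℝ) (G₁ p p₁) g₁ (E p p₁) ∧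
        DifferentiableOn ℂ (G₂ p p₁) (E p p₁) ∧
        RamisSibuya.HasQGevreyExpansion q κ (G₂ p p₁) g₂ (E p p₁) := by
  classical
  have hcov := hE.isConicCovering
  set ι := Σ p : Fin ς, Fin (χ p) with hι
  set E' : ι → Set ℂ := fun i => E i.1 i.2 with hE'
  set Δ : ι → ι → ℂ → F := fun i j z => G j.1 j.2 z - G i.1 i.2 z with hΔ
  have hΔd : ∀ i j, DifferentiableOn ℂ (Δ i j) (E' i ∩ E' j) := fun i j =>
    ((hG j.1 j.2).mono Set.inter_subset_right).sub ((hG i.1 i.2).mono Set.inter_subset_left)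
  -- the two parts of the cocycle: indices with the same `p`, and with different ones
  set δ₁ : ι → ι → ℂ → F := fun i j z => if i.1 = j.1 then Δ i j z else 0 with hδ₁
  set δ₂ : ι → ι → ℂ → F := fun i j z => if i.1 = j.1 then 0 else Δ i j z with hδ₂
  have hadd : ∀ i j z, δ₁ i j z + δ₂ i j z = Δ i j z := fun i j z => by
    simp only [hδ₁, hδ₂]
    split_ifs <;> simp
  have hδ₁d : ∀ i j, DifferentiableOn ℂ (δ₁ i j) (E' i ∩ E' j) := fun i j => by
    by_cases h : i.1 = j.1
    · simpa only [hδ₁, h, if_true] using hΔd i j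
    · simpa only [hδ₁, h, if_false] using differentiableOn_const (0 : F)
  have hδ₂d : ∀ i j, DifferentiableOn ℂ (δ₂ i j) (E' i ∩ E' j) := fun i j => by
    by_cases h : i.1 = j.1
    · simpa only [hδ₂, h, if_true] using differentiableOn_const (0 : F)
    · simpa only [hδ₂, h, if_false] using hΔd i j
  -- as three different sectors never meet, the cocycle condition only concerns repeated indices
  have hδ₁c : ∀ i j l, ∀ z ∈ E' i, z ∈ E' j → z ∈ E' l → δ₁ i j z + δ₁ j l z = δ₁ i l z := by
    intro i j l z hi hj hl
    by_cases h1 : i = j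
    · subst h1; simp [hδ₁, hΔ]
    by_cases h2 : j = l
    · subst h2; simp [hδ₁, hΔ]
    by_cases h3 : i = l
    · subst h3
      simp only [hδ₁, hΔ, eq_comm (a := j.1)]
      split_ifs <;> simp
    exact absurd (hE.triple i j l h1 h2 h3) (Set.nonempty_iff_ne_empty.1 ⟨z, ⟨hi, hj⟩, hl⟩)
  have hδ₂c : ∀ i j l, ∀ z ∈ E' i, z ∈ E' j → z ∈ E' l → δ₂ i j z + δ₂ j l z = δ₂ i l z := by
    intro i j l z hi hj hl
    have h1 := hδ₁c i j l z hi hj hl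
    have h2 : Δ i j z + Δ j l z = Δ i l z := by simp [hΔ]
    rw [← hadd, ← hadd, ← hadd, ← h1] at h2
    have h3 : δ₁ i j z + δ₁ j l z + (δ₂ i j z + δ₂ j l z) =
        δ₁ i j z + δ₁ j l z + δ₂ i l z := by rw [← h2]; abel
    exact add_left_cancel h3
  obtain ⟨K, A, hK, hA, hb₁⟩ := RamisSibuya.exists_uniform_geometric_bound (P := ι × ι)
    (X := fun p N x => ∀ z ∈ E' p.1, z ∈ E' p.2 →
      ‖δ₁ p.1 p.2 z‖ ≤ x * (Nat.factorial N : ℝ) ^ (1 / (k : ℝ)) * ‖z‖ ^ N)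
    (fun p N x y hxy h z h1 h2 => (h z h1 h2).trans (by gcongr)) (by
      rintro ⟨i, j⟩
      by_cases h : i ≠ j ∧ i.1 = j.1 ∧ (E' i ∩ E' j).Nonempty
      · obtain ⟨p, p₁⟩ := i
        obtain ⟨p', p₂⟩ := j
        obtain ⟨hne, hp, hnon⟩ := h
        obtain rfl : p = p' := hp
        obtain ⟨K₁, M₁, hK₁, hM₁, hb⟩ := hexp p p₁ p₂ (fun h => hne (by rw [h])) hnon
        refine ⟨K₁, (M₁ ^ (1 / (k : ℝ)))⁻¹, hK₁.le, by positivity, fun N z h1 h2 => ?_⟩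
        have hz : 0 < ‖z‖ := norm_pos_iff.2 (hcov.ne_zero (i := ⟨p, p₁⟩) h1)
        simp only [hδ₁, hΔ, if_true]
        refine (hb z ⟨h1, h2⟩).trans ?_
        rw [mul_assoc, mul_assoc, ← mul_assoc (_ ^ N)]
        gcongr
        exact RamisSibuya.exp_neg_div_pow_le hk hM₁ hz N
      · refine ⟨0, 0, le_rfl, le_rfl, fun N z h1 h2 => ?_⟩
        have : δ₁ i j z = 0 := by
          by_cases hij : i = j
          · subst hij; simp [hδ₁, hΔ]
          · have : i.1 ≠ j.1 := fun h' => h ⟨hij, h', z, h1, h2⟩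
            simp only [hδ₁, this, if_false]
        simp [this])
  obtain ⟨K', A', hK', hA', hb₂⟩ := RamisSibuya.exists_uniform_geometric_bound (P := ι × ι)
    (X := fun p N x => ∀ z ∈ E' p.1, z ∈ E' p.2 →
      ‖δ₂ p.1 p.2 z‖ ≤ x * q ^ ((N : ℝ) ^ 2 / (2 * κ)) * ‖z‖ ^ N)
    (fun p N x y hxy h z h1 h2 => (h z h1 h2).trans (by gcongr)) (by
      rintro ⟨i, j⟩
      by_cases h : i.1 ≠ j.1 ∧ (E' i ∩ E' j).Nonempty
      · obtain ⟨K₂, M₂, hK₂, hb⟩ := hqexp i.1 j.1 i.2 j.2 h.1 h.2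
        refine ⟨K₂ * q ^ (M₂ ^ 2 / (2 * κ)), q ^ (-(M₂ / κ)), by positivity, by positivity,
          fun N z h1 h2 => ?_⟩
        have hz : 0 < ‖z‖ := norm_pos_iff.2 (hcov.ne_zero (i := i) h1)
        simp only [hδ₂, hΔ, h.1, if_false]
        refine (hb z ⟨h1, h2⟩).trans ?_
        have := mul_le_mul_of_nonneg_left
          (RamisSibuya.rpow_mul_exp_neg_log_sq_le hq hκ M₂ hz N) hK₂.le
        simp only [mul_assoc] at this ⊢
        exact this
      · refine ⟨0, 0, le_rfl, le_rfl, fun N z h1 h2 => ?_⟩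
        have : δ₂ i j z = 0 := by
          have : i.1 = j.1 := by
            by_contra h'
            exact h ⟨h', z, h1, h2⟩
          simp only [hδ₂, this, if_true]
        simp [this])
  obtain ⟨Ψ₁, g₁, C₁, hC₁, hΨ₁d, hΨ₁s, hΨ₁b⟩ := hcov.exists_holomorphic_splitting δ₁
    (fun N => K * A ^ N * (Nat.factorial N : ℝ) ^ (1 / (k : ℝ))) hδ₁d hδ₁c
    (fun N => by positivity) (fun i j N => hb₁ (i, j) N)
  obtain ⟨Ψ₂, g₂, C₂, hC₂, hΨ₂d, hΨ₂s, hΨ₂b⟩ := hcov.exists_holomorphic_splitting δ₂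
    (fun N => K' * A' ^ N * q ^ ((N : ℝ) ^ 2 / (2 * κ))) hδ₂d hδ₂c
    (fun N => by positivity) (fun i j N => hb₂ (i, j) N)
  obtain ⟨a, c, hac, ha⟩ := hcov.exists_hasSum
    (fun i z => G i.1 i.2 z - (Ψ₁ i z + Ψ₂ i z))
    (fun i => (hG i.1 i.2).sub ((hΨ₁d i).add (hΨ₂d i)))
    (fun i j z hi hj => by
      have h1 : Ψ₁ j z = Ψ₁ i z + δ₁ i j z := by rw [← hΨ₁s i j z hi hj]; abel
      have h2 : Ψ₂ j z = Ψ₂ i z + δ₂ i j z := by rw [← hΨ₂s i j z hi hj]; abel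
      have h3 : G j.1 j.2 z = G i.1 i.2 z + (δ₁ i j z + δ₂ i j z) := by
        simp only [hadd, hΔ, add_sub_cancel]
      simp only [h1, h2, h3]
      abel)
    (fun i => by
      obtain ⟨C, ρ, hρ, hC⟩ := hbdd i.1 i.2
      have h1 := hΨ₁b i 0
      have h2 := hΨ₂b i 0
      simp only [Finset.range_zero, Finset.sum_empty, sub_zero] at h1 h2
      simp only [pow_zero, mul_one] at h1 h2
      exact ⟨_, ρ, hρ, fun z hz hzρ => (norm_sub_le _ _).trans (add_le_add (hC z hz hzρ)
        ((norm_add_le _ _).trans (add_le_add (h1 z hz) (h2 z hz))))⟩)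
  refine ⟨a, c, g₁, g₂, fun p p₁ => Ψ₁ ⟨p, p₁⟩, fun p p₁ => Ψ₂ ⟨p, p₁⟩, hac, fun p p₁ =>
    ⟨fun ε hε => ?_, hΨ₁d ⟨p, p₁⟩, fun α β r _ _ hW => ?_, hΨ₂d ⟨p, p₁⟩, fun α β r _ _ hW => ?_⟩⟩
  · rw [← ha ⟨p, p₁⟩ ε hε]
    abel
  · refine ⟨C₁ * (K * (1 + A)) + 1, 2 * A, by positivity, by positivity, fun N _ ε hε => ?_⟩
    refine (hΨ₁b ⟨p, p₁⟩ N ε (hW hε)).trans ?_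
    have h := mul_le_mul_of_nonneg_left (RamisSibuya.gevrey_moment_add_le hk hA.le N)
      (mul_nonneg hC₁ hK)
    refine mul_le_mul_of_nonneg_right ?_ (by positivity)
    have h2 : 0 ≤ (2 * A) ^ N * (Nat.factorial N : ℝ) ^ (1 / (k : ℝ)) := by positivity
    linear_combination h + h2
  · refine ⟨C₂ * (K' * ((1 + A') * q ^ (1 / (2 * κ)))) + 1, A' * q ^ (3 / (2 * κ)),
      by positivity, by positivity, fun N ε hε => ?_⟩
    have hεE : ε ∈ E' ⟨p, p₁⟩ := by
      refine hW ⟨subset_closure hε, ?_⟩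
      obtain ⟨ρ, φ, hρ, -, -, -, rfl⟩ := hε
      exact mul_ne_zero (by exact_mod_cast hρ.ne') (Complex.exp_ne_zero _)
    refine (hΨ₂b ⟨p, p₁⟩ (N + 1) ε hεE).trans ?_
    have h := mul_le_mul_of_nonneg_left (RamisSibuya.qGevrey_moment_add_le hq hκ hA'.le N)
      (mul_nonneg hC₂ hK')
    refine mul_le_mul_of_nonneg_right ?_ (by positivity)
    have h2 : 0 ≤ (A' * q ^ (3 / (2 * κ))) ^ (N + 1) *
        q ^ ((((N : ℝ) + 1) * (N : ℝ)) / (2 * κ)) := by positivity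
    linear_combination h + h2
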